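/- All rings are associative with $1$, not necessarily commutative. An element $a$ of a ring $R$ is called weakly nil-clean if there are a nilpotent $b\in R$ and an idempotent $e\in R$ such that $a=b+e$ or $a=b-e$; the ring $R$ is called weakly nil-clean if each of its elements is weakly nil-clean. Theorem. Let $D$ be a division ring and let $n\ge 1$ be an integer. Then the ring $\mathbb M_n(D)$ of $n\times n$ matrices over $D$ is weakly nil-clean if and only if either (1) $D\cong \mathbb Z_2$, or (2) $D\cong \mathbb Z_3$ and $n=1$, where $\mathbb Z_m=\mathbb Z/m\mathbb Z$ and $\cong$ denotes isomorphism of rings. -/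

import Mathlib

/-- An element of a (not necessarily commutative) ring is weakly nil-clean if it is a sum or
a difference of a nilpotent and an idempotent. -/
def IsWeaklyNilCleanElem {R : Type*} [Ring R] (a : R) : Prop :=
  ∃ b e : R, IsNilpotent b ∧ IsIdempotentElem e ∧ (a = b + e ∨ a = b - e)

/-- A ring is weakly nil-clean if each of its elements is. -/
def IsWeaklyNilCleanRing (R : Type*) [Ring R] : Prop :=
  ∀ a : R, IsWeaklyNilCleanElem a

/-! Over `ZMod 2` every endomorphism is nil-clean. A Krylov subspace is invariant, so induction on
dimension via block triangular form reduces to a cyclic block (`isNilCleanElem_of_cyclic`); there an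
idempotent of rank one or two, according to the trace, is subtracted to leave a single nilpotent
Jordan chain, sizes one and two with trace zero being treated by hand. Conversely, `a e₁₁` is
nil-clean only for `a ∈ {0, 1}`, so weak nil-cleanness forces every scalar into `{0, 1, -1}` and `D`
has two or three elements. With three elements and `n ≥ 2`, the matrix `-1 - e₁₁` is a
counterexample. Noncommutativity rules out determinants, so both obstructions follow one row vector
`y` through an `N`-invariant space of dimension at most two. -/

/-- An element of a ring is nil-clean if it is the sum of a nilpotent and an idempotent. -/
def IsNilCleanElem {R : Type*} [Ring R] (a : R) : Prop :=
  ∃ b e : R, IsNilpotent b ∧ IsIdempotentElem e ∧ a = b + e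

/-! ### Block triangular reduction -/

section Triangular

variable {K V W U : Type*} [Ring K] [AddCommGroup V] [Module K V] [AddCommGroup W] [Module K W]
  [AddCommGroup U] [Module K U]

theorem isNilpotent_of_block {N : Module.End K V} {N₁ : Module.End K W} {N₂ : Module.End K U}
    {ι : W →ₗ[K] V} {q : V →ₗ[K] U} (hexact : ∀ x, q x = 0 → ∃ w, ι w = x)
    (h₁ : ∀ w, N (ι w) = ι (N₁ w)) (h₂ : ∀ x, q (N x) = N₂ (q x))
    (hN₁ : IsNilpotent N₁) (hN₂ : IsNilpotent N₂) : IsNilpotent N := by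
  obtain ⟨a, ha⟩ := hN₁
  obtain ⟨b, hb⟩ := hN₂
  have k₁ : ∀ (k : ℕ) w, (N ^ k) (ι w) = ι ((N₁ ^ k) w) := by
    intro k
    induction k with
    | zero => intro w; simp
    | succ k ih => intro w; rw [pow_succ, pow_succ, Module.End.mul_apply, h₁, ih]; rfl
  have k₂ : ∀ (k : ℕ) x, q ((N ^ k) x) = (N₂ ^ k) (q x) := by
    intro k
    induction k with
    | zero => intro w; simp
    | succ k ih => intro x; rw [pow_succ, pow_succ, Module.End.mul_apply, ih, h₂]; rfl
  refine ⟨a + b, LinearMap.ext fun x => ?_⟩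
  obtain ⟨w, hw⟩ := hexact ((N ^ b) x) (by rw [k₂, hb]; simp)
  rw [pow_add, Module.End.mul_apply, ← hw, k₁, ha]
  simp

/-- The block diagonal sum of the two idempotents is idempotent; what remains is block triangular
with nilpotent diagonal blocks. -/
theorem isNilCleanElem_of_block {T : Module.End K V} (ι : W →ₗ[K] V) (p : V →ₗ[K] W)
    (s : U →ₗ[K] V) (q : V →ₗ[K] U) (hpι : ∀ w, p (ι w) = w) (hqs : ∀ u, q (s u) = u)
    (hps : ∀ u, p (s u) = 0) (hqι : ∀ w, q (ι w) = 0) (hdec : ∀ x, ι (p x) + s (q x) = x)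
    (hT : ∀ w, q (T (ι w)) = 0)
    (h₁ : IsNilCleanElem (R := Module.End K W) (p ∘ₗ T ∘ₗ ι))
    (h₂ : IsNilCleanElem (R := Module.End K U) (q ∘ₗ T ∘ₗ s)) : IsNilCleanElem T := by
  obtain ⟨N₁, E₁, hN₁, hE₁, e₁⟩ := h₁
  obtain ⟨N₂, E₂, hN₂, hE₂, e₂⟩ := h₂
  have hE₁' : ∀ w, E₁ (E₁ w) = E₁ w := fun w => LinearMap.congr_fun hE₁ w
  have hE₂' : ∀ w, E₂ (E₂ w) = E₂ w := fun w => LinearMap.congr_fun hE₂ w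
  have e₁' : ∀ w, p (T (ι w)) = N₁ w + E₁ w := fun w => LinearMap.congr_fun e₁ w
  have e₂' : ∀ w, q (T (s w)) = N₂ w + E₂ w := fun w => LinearMap.congr_fun e₂ w
  let E : Module.End K V := ι ∘ₗ E₁ ∘ₗ p + s ∘ₗ E₂ ∘ₗ q
  have hE : ∀ x, E x = ι (E₁ (p x)) + s (E₂ (q x)) := fun x => rfl
  refine ⟨T - E, E, isNilpotent_of_block (ι := ι) (q := q) ?_ ?_ ?_ hN₁ hN₂, ?_, by simp⟩
  · intro x hx
    exact ⟨p x, by simpa [hx] using hdec x⟩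
  · intro w
    have := hdec (T (ι w))
    rw [hT, e₁', map_zero, add_zero, map_add] at this
    rw [LinearMap.sub_apply, ← this, hE, hpι, hqι]
    simp
  · intro x
    have : q (T x) = q (T (ι (p x) + s (q x))) := by rw [hdec]
    rw [map_add, map_add, hT, zero_add, e₂'] at this
    rw [LinearMap.sub_apply, map_sub, this, hE, map_add, hqι, hqs]
    simp
  · refine LinearMap.ext fun x => ?_
    simp [hE, hpι, hqs, hps, hqι, hE₁', hE₂']

end Triangular

/-! ### Companion matrices -/

section Cyclic

theorem isNilpotent_of_cyclic {ι K : Type*} [Ring K] {V : Type*} [AddCommGroup V] [Module K V]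
    (b : Module.Basis ι K V) {N : Module.End K V} (x : V) {r : ℕ} (hr : (N ^ r) x = 0)
    (hb : ∀ i, b i ∈ Submodule.span K (Set.range fun j : ℕ => (N ^ j) x)) : IsNilpotent N := by
  refine ⟨r, b.ext fun i => ?_⟩
  have hle : Submodule.span K (Set.range fun j : ℕ => (N ^ j) x) ≤ LinearMap.ker (N ^ r) := by
    rw [Submodule.span_le]
    rintro _ ⟨j, rfl⟩
    change (N ^ r) ((N ^ j) x) = 0
    rw [← Module.End.mul_apply, ← pow_add, add_comm, pow_add, Module.End.mul_apply, hr, map_zero]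
  exact hle (hb i)

/-- The coordinate in `h` is the trace of the companion matrix. Its last column alone is then a rank
one idempotent, and removing it leaves the shift. -/
theorem isNilCleanElem_of_cyclic_of_coord_eq_one {K : Type*} [Field K] {V : Type*}
    [AddCommGroup V] [Module K V] {k : ℕ}
    (b : Module.Basis (Fin (k + 1)) K V) {T : Module.End K V} {v : V}
    (hb : ∀ i, b i = (T ^ (i : ℕ)) v)
    (h : b.coord (Fin.last k) ((T ^ (k + 1)) v) = 1) : IsNilCleanElem T := by
  let E : Module.End K V := (b.coord (Fin.last k)).smulRight ((T ^ (k + 1)) v)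
  have hE : ∀ x, E x = b.coord (Fin.last k) x • ((T ^ (k + 1)) v) := fun x => rfl
  have hN : ∀ j ≤ k, ((T - E) ^ j) v = (T ^ j) v := by
    intro j
    induction j with
    | zero => simp
    | succ j ih =>
      intro hj
      have hbj := hb ⟨j, by omega⟩
      rw [pow_succ', Module.End.mul_apply, ih (by omega), LinearMap.sub_apply, hE]
      simp only at hbj
      rw [← hbj, Module.Basis.coord_apply, Module.Basis.repr_self, Finsupp.single_eq_of_ne, hbj,
        ← Module.End.mul_apply, ← pow_succ', zero_smul, sub_zero]
      simp [Fin.ext_iff]; omega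
  refine ⟨T - E, E, isNilpotent_of_cyclic b v (r := k + 1) ?_ ?_, ?_, by simp⟩
  · have hbk := hb (Fin.last k)
    rw [Fin.val_last] at hbk
    rw [pow_succ', Module.End.mul_apply, hN k le_rfl, LinearMap.sub_apply, hE, ← hbk,
      Module.Basis.coord_apply, Module.Basis.repr_self, Finsupp.single_eq_same, hbk,
      ← Module.End.mul_apply, ← pow_succ', one_smul, sub_self]
  · intro i
    exact Submodule.subset_span ⟨i, by simp only; rw [hN i (by omega), hb]⟩
  · refine LinearMap.ext fun x => ?_
    rw [Module.End.mul_apply, hE x, map_smul, hE, h, one_smul]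

variable {V : Type*} [AddCommGroup V] [Module (ZMod 2) V]

/-- With trace zero, an idempotent of rank two is subtracted so that `v, T v, …, T ^ (k + 1) v, u`
becomes a Jordan chain. -/
theorem isNilCleanElem_of_cyclic_of_coord_eq_zero {k : ℕ}
    (b : Module.Basis (Fin (k + 3)) (ZMod 2) V) {T : Module.End (ZMod 2) V} {v : V}
    (hb : ∀ i, b i = (T ^ (i : ℕ)) v)
    (h : b.coord (Fin.last (k + 2)) ((T ^ (k + 3)) v) = 0) : IsNilCleanElem T := by
  set φ := b.coord ⟨k + 1, by omega⟩ with hφ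
  set ψ := b.coord (Fin.last (k + 2)) with hψ
  set e : ℕ → V := fun i => (T ^ i) v with he
  have hTe : ∀ i, T (e i) = e (i + 1) := fun i => by
    simp only [he]; rw [pow_succ', Module.End.mul_apply]
  have hbe : ∀ (i : ℕ) (hi : i < k + 3), b ⟨i, hi⟩ = e i := fun i hi => hb _
  have hφe : ∀ i < k + 3, φ (e i) = if i = k + 1 then 1 else 0 := fun i hi => by
    rw [← hbe i hi, hφ, Module.Basis.coord_apply, Module.Basis.repr_self, Finsupp.single_apply]
    simp [Fin.ext_iff]
  have hψe : ∀ i < k + 3, ψ (e i) = if i = k + 2 then 1 else 0 := fun i hi => by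
    rw [← hbe i hi, hψ, Module.Basis.coord_apply, Module.Basis.repr_self, Finsupp.single_apply]
    simp [Fin.ext_iff]
  have h' : ψ (e (k + 3)) = 0 := h
  -- `α` is the value giving `φ z = 0`; `y` is forced by `N e (k + 1) = u` and `z` by `N u = 0`,
  -- where `N = T - E`.
  set α : ZMod 2 := φ (e (k + 3)) + 1 with hα
  set u : V := e (k + 2) - e (k + 1) - α • e k with hu
  set y : V := e (k + 1) + α • e k with hy
  set z : V := e (k + 2) + T u - u with hz
  have hTu : T u = e (k + 3) - e (k + 2) - α • e (k + 1) := by simp [hu, hTe]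
  have two : (1 : ZMod 2) + 1 = 0 := by decide
  have φe0 := hφe k (by omega)
  have φe1 := hφe (k + 1) (by omega)
  have φe2 := hφe (k + 2) (by omega)
  have ψe0 := hψe k (by omega)
  have ψe1 := hψe (k + 1) (by omega)
  have ψe2 := hψe (k + 2) (by omega)
  simp at φe0 φe1 φe2 ψe0 ψe1 ψe2
  have φu : φ u = -1 := by simp [hu, φe0, φe1, φe2]
  have ψu : ψ u = 1 := by simp [hu, ψe0, ψe1, ψe2]
  have φy : φ y = 1 := by simp [hy, φe0, φe1]
  have ψy : ψ y = 0 := by simp [hy, ψe0, ψe1]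
  have φz : φ z = 0 := by
    simp only [hz, map_add, map_sub, hTu, map_smul, φu, φe2, φe1, smul_eq_mul, hα]
    ring
  -- The value computed is `-1`: characteristic two enters here.
  have ψz : ψ z = 1 := by
    simp only [hz, map_add, map_sub, hTu, map_smul, ψu, ψe2, ψe1, smul_eq_mul, h']
    linear_combination -two
  let E : Module.End (ZMod 2) V := φ.smulRight y + ψ.smulRight z
  have hE : ∀ x, E x = φ x • y + ψ x • z := fun x => rfl
  have hN : ∀ j ≤ k + 1, ((T - E) ^ j) v = e j := by
    intro j
    induction j with
    | zero => intro _; simp [he]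
    | succ j ih =>
      intro hj
      rw [pow_succ', Module.End.mul_apply, ih (by omega), LinearMap.sub_apply, hE, hTe,
        hφe j (by omega), hψe j (by omega), if_neg (by omega), if_neg (by omega)]
      simp
  have hNu : ((T - E) ^ (k + 2)) v = u := by
    rw [pow_succ', Module.End.mul_apply, hN _ le_rfl, LinearMap.sub_apply, hE, hTe, φe1, ψe1,
      zero_smul, one_smul, add_zero, hu, hy]
    abel
  refine ⟨T - E, E, isNilpotent_of_cyclic b v (r := k + 3) ?_ ?_, ?_, by simp⟩
  · rw [pow_succ', Module.End.mul_apply, hNu, LinearMap.sub_apply, hE, φu, ψu, hz, hy, one_smul,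
      neg_smul, one_smul]
    nth_rewrite 3 [hu]
    abel
  · rintro ⟨i, hi⟩
    rw [hbe]
    have hmem : ∀ j ≤ k + 1, e j ∈ Submodule.span (ZMod 2)
        (Set.range fun j : ℕ => ((T - E) ^ j) v) := fun j hj =>
      Submodule.subset_span ⟨j, hN j hj⟩
    by_cases hi' : i ≤ k + 1
    · exact hmem i hi'
    · obtain rfl : i = k + 2 := by omega
      have : e (k + 2) = u + e (k + 1) + α • e k := by rw [hu]; abel
      rw [this]
      exact add_mem (add_mem (Submodule.subset_span ⟨k + 2, hNu⟩) (hmem _ le_rfl))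
        (Submodule.smul_mem _ _ (hmem _ (by omega)))
  · refine LinearMap.ext fun x => ?_
    rw [Module.End.mul_apply, hE, hE]
    simp [φy, φz, ψy, ψz]

theorem isNilCleanElem_of_cyclic {m : ℕ}
    (b : Module.Basis (Fin m) (ZMod 2) V) {T : Module.End (ZMod 2) V} {v : V}
    (hb : ∀ i, b i = (T ^ (i : ℕ)) v) : IsNilCleanElem T := by
  have dich : ∀ c : ZMod 2, c = 0 ∨ c = 1 := by decide
  match m, b, hb with
  | 0, b, hb =>
    exact ⟨0, T, IsNilpotent.zero, b.ext fun i => i.elim0, by simp⟩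
  | 1, b, hb =>
    rcases dich (b.coord (Fin.last 0) ((T ^ 1) v)) with h | h
    · refine ⟨T, 0, ⟨1, b.ext fun i => ?_⟩, IsIdempotentElem.zero, by simp⟩
      have := b.sum_repr (T v)
      have h0 : b 0 = v := hb 0
      obtain rfl : i = 0 := Subsingleton.elim _ _
      simp at h this
      rw [h0, pow_one, ← this, h]
      simp
    · exact isNilCleanElem_of_cyclic_of_coord_eq_one b hb h
  | 2, b, hb =>
    rcases dich (b.coord (Fin.last 1) ((T ^ 2) v)) with h | h
    · have h0 : b 0 = v := by simpa using hb 0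
      have h1 : b 1 = T v := by simpa using hb 1
      have hs := b.sum_repr ((T ^ 2) v)
      have h' : b.repr ((T ^ 2) v) 1 = 0 := h
      rw [Fin.sum_univ_two, h', zero_smul, add_zero, h0] at hs
      rcases dich (b.repr ((T ^ 2) v) 0) with hc | hc
      · rw [hc, zero_smul] at hs
        refine ⟨T, 0, ⟨2, b.ext fun i => ?_⟩, IsIdempotentElem.zero, by simp⟩
        rw [hb, ← Module.End.mul_apply, ← pow_add, add_comm, pow_add, Module.End.mul_apply, ← hs]
        simp
      · rw [hc, one_smul] at hs
        have hT : T ^ 2 = 1 := b.ext fun i => by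
          rw [hb, ← Module.End.mul_apply, ← pow_add, add_comm, pow_add, Module.End.mul_apply, ← hs]
          simp
        refine ⟨T - 1, 1, ⟨2, ?_⟩, IsIdempotentElem.one, by simp⟩
        have two : (1 : ZMod 2) + 1 = 0 := by decide
        have h2 : ∀ x : V, x + x = 0 := fun x => by
          rw [← one_smul (ZMod 2) x, ← add_smul, two, zero_smul]
        refine LinearMap.ext fun x => ?_
        have hTx : T (T x) = x := by
          rw [← Module.End.mul_apply, ← pow_two, hT]; rfl
        simp only [pow_two, Module.End.mul_apply, LinearMap.sub_apply, Module.End.one_apply, map_sub,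
          hTx, LinearMap.zero_apply]
        have e : x - T x - (T x - x) = (x + x) - (T x + T x) := by abel
        rw [e, h2, h2, sub_zero]
    · exact isNilCleanElem_of_cyclic_of_coord_eq_one b hb h
  | k + 3, b, hb =>
    rcases dich (b.coord (Fin.last (k + 2)) ((T ^ (k + 3)) v)) with h | h
    · exact isNilCleanElem_of_cyclic_of_coord_eq_zero b hb h
    · exact isNilCleanElem_of_cyclic_of_coord_eq_one b hb h

end Cyclic

/-! ### Krylov subspaces and induction on dimension -/

/-- A nonzero vector generates a nonzero invariant subspace with a basis of iterates. -/
theorem exists_krylov {K V : Type*} [Field K] [AddCommGroup V] [Module K V]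
    [FiniteDimensional K V] (T : Module.End K V) {v : V} (hv : v ≠ 0) :
    ∃ d : ℕ, LinearIndependent K (fun i : Fin d => (T ^ (i : ℕ)) v) ∧
      v ∈ Submodule.span K (Set.range fun i : Fin d => (T ^ (i : ℕ)) v) ∧
      ∀ x ∈ Submodule.span K (Set.range fun i : Fin d => (T ^ (i : ℕ)) v),
        T x ∈ Submodule.span K (Set.range fun i : Fin d => (T ^ (i : ℕ)) v) := by
  classical
  have hex : ∃ d : ℕ, ¬ LinearIndependent K (fun i : Fin (d + 1) => (T ^ (i : ℕ)) v) := by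
    refine ⟨Module.finrank K V, fun h => ?_⟩
    have := h.fintype_card_le_finrank
    simp at this
  obtain ⟨d, hd, hmin⟩ : ∃ d : ℕ, ¬ LinearIndependent K (fun i : Fin (d + 1) => (T ^ (i : ℕ)) v) ∧
      ∀ c < d, LinearIndependent K (fun i : Fin (c + 1) => (T ^ (i : ℕ)) v) :=
    ⟨Nat.find hex, Nat.find_spec hex, fun c hc => not_not.1 (Nat.find_min hex hc)⟩
  obtain _ | d := d
  · exact absurd (LinearIndependent.of_subsingleton (ι := Fin 1) 0 (by simpa using hv)) hd
  have hli := hmin d (by omega)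
  refine ⟨d + 1, hli, Submodule.subset_span ⟨0, by simp⟩, ?_⟩
  have hlast : (T ^ (d + 1)) v ∈
      Submodule.span K (Set.range fun i : Fin (d + 1) => (T ^ (i : ℕ)) v) := by
    by_contra hc
    exact hd (linearIndependent_finSucc'.2 ⟨hli, by simpa [Fin.init_def] using hc⟩)
  intro x hx
  refine (Submodule.span_le (p := Submodule.comap T (Submodule.span K _))).2 ?_ hx
  rintro _ ⟨i, rfl⟩
  rw [SetLike.mem_coe, Submodule.mem_comap, ← Module.End.mul_apply, ← pow_succ']
  by_cases hi : (i : ℕ) < d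
  · exact Submodule.subset_span ⟨⟨i + 1, by omega⟩, rfl⟩
  · have : (i : ℕ) = d := by omega
    rw [this]
    exact hlast

theorem isNilCleanElem_end_zmod_two (V : Type*) [AddCommGroup V] [Module (ZMod 2) V]
    [FiniteDimensional (ZMod 2) V] (T : Module.End (ZMod 2) V) : IsNilCleanElem T := by
  induction hn : Module.finrank (ZMod 2) V using Nat.strong_induction_on generalizing V with
  | _ n ih =>
  subst hn
  rcases subsingleton_or_nontrivial V with hV | hV
  · exact ⟨0, T, IsNilpotent.zero, Subsingleton.elim _ _, by simp⟩
  obtain ⟨v, hv⟩ := exists_ne (0 : V)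
  obtain ⟨d, hli, hvW, hW⟩ := exists_krylov T hv
  set W := Submodule.span (ZMod 2) (Set.range fun i : Fin d => (T ^ (i : ℕ)) v) with hWdef
  by_cases htop : W = ⊤
  · exact isNilCleanElem_of_cyclic (Module.Basis.mk hli htop.ge) (v := v) (by simp)
  obtain ⟨U, hU⟩ := W.exists_isCompl
  have hsum := Submodule.finrank_add_eq_of_isCompl hU
  have hWlt := Submodule.finrank_lt htop
  have hWpos : 0 < Module.finrank (ZMod 2) W :=
    Module.finrank_pos_iff_exists_ne_zero.2 ⟨⟨v, hvW⟩, fun h => hv (congrArg Subtype.val h)⟩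
  refine isNilCleanElem_of_block W.subtype (W.projectionOnto U hU) U.subtype
    (U.projectionOnto W hU.symm) ?_ ?_ ?_ ?_ ?_ ?_ (ih _ hWlt W _ rfl) (ih _ (by omega) U _ rfl)
  · exact Submodule.projectionOnto_apply_left hU
  · exact Submodule.projectionOnto_apply_left hU.symm
  · exact Submodule.projectionOnto_apply_right hU
  · exact Submodule.projectionOnto_apply_right hU.symm
  · exact fun x => Submodule.projection_add_projection_eq_self hU x
  · exact fun w => Submodule.projectionOnto_apply_of_mem_right hU.symm (hW _ w.2)

/-! ### Obstructions over a division ring -/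

section RowVectors

open Matrix

variable {D ι : Type*} [DivisionRing D] [Fintype ι] [DecidableEq ι]

/-- A nilpotent acting on the span of `y` and `y N`, of dimension at most two, has square zero
there. The recurrence lowers a vanishing exponent one step at a time. -/
theorem vecMul_vecMul_eq_zero_of_isNilpotent {N : Matrix ι ι D} (hN : IsNilpotent N) {y : ι → D}
    {c d : D} (h : y ᵥ* N ᵥ* N = c • y + d • (y ᵥ* N)) : y ᵥ* N ᵥ* N = 0 := by
  have step : ∀ r : ℕ, y ᵥ* N ^ (r + 2) = 0 → y ᵥ* N ᵥ* N = 0 := by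
    intro r
    induction r with
    | zero => intro h0; simpa [pow_two] using h0
    | succ r ih =>
      intro h0
      have key : ∀ s : ℕ, y ᵥ* N ^ (s + 2) = c • (y ᵥ* N ^ s) + d • (y ᵥ* N ^ (s + 1)) := by
        intro s
        have := congrArg (· ᵥ* N ^ s) h
        simp only [add_vecMul, smul_vecMul, vecMul_vecMul] at this
        rw [add_comm s 2, add_comm s 1, pow_add, pow_add, pow_two, pow_one, this]
      have h4 : y ᵥ* N ^ (r + 4) = 0 := by
        rw [show r + 4 = r + 3 + 1 from rfl, pow_succ, ← vecMul_vecMul]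
        rw [show r + 3 = r + 1 + 2 from rfl, h0, zero_vecMul]
      have k1 := key (r + 2)
      rw [show r + 2 + 2 = r + 4 from rfl, h4, show r + 2 + 1 = r + 1 + 2 from rfl, h0, smul_zero,
        add_zero, eq_comm, smul_eq_zero] at k1
      rcases k1 with hc | hz
      · have k2 := key (r + 1)
        rw [h0, hc, zero_smul, zero_add, eq_comm, smul_eq_zero] at k2
        rcases k2 with hd | hz
        · rw [h, hc, hd]; simp
        · exact ih hz
      · exact ih hz
  obtain ⟨k, hk⟩ := hN
  refine step k ?_
  rw [pow_add, hk]
  simp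

theorem eigenvalue_eq_zero_of_isNilpotent {N : Matrix ι ι D} (hN : IsNilpotent N) {y : ι → D}
    (hy : y ≠ 0) {c : D} (h : y ᵥ* N = c • y) : c = 0 := by
  have h2 : y ᵥ* N ᵥ* N = (c * c) • y := by rw [h, smul_vecMul, h, smul_smul]
  have h0 := vecMul_vecMul_eq_zero_of_isNilpotent hN (c := c * c) (d := 0) (by rw [h2]; simp)
  rw [h2, smul_eq_zero, or_iff_left hy] at h0
  simpa using h0

theorem vecMul_single (i : ι) (a : D) (x : ι → D) :
    x ᵥ* Matrix.single i i a = (x i * a) • Pi.single i (1 : D) := by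
  ext j
  by_cases hj : j = i
  · subst hj; simp [vecMul, dotProduct, Matrix.single_apply]
  · simp [vecMul, dotProduct, hj, Ne.symm hj]

/-- A rank one matrix `a e₁₁` is nil-clean only for `a ∈ {0, 1}`. -/
theorem eq_zero_or_one_of_isNilCleanElem_single {i : ι} {a : D}
    (h : IsNilCleanElem (Matrix.single i i a)) : a = 0 ∨ a = 1 := by
  obtain ⟨N, E, hN, hE, hA⟩ := h
  set y : ι → D := Pi.single i 1 with hy
  have hy0 : y ≠ 0 := by simp [hy]
  set u := y ᵥ* E with hu
  have huE : u ᵥ* E = u := by rw [hu, vecMul_vecMul, hE]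
  have hNx : ∀ x : ι → D, x ᵥ* N = (x i * a) • y - x ᵥ* E := fun x => by
    rw [← vecMul_single, hA, vecMul_add]; simp
  have hNy : y ᵥ* N = a • y - u := by rw [hNx, ← hu]; simp [hy]
  have hNu : u ᵥ* N = (u i * a) • y - u := by rw [hNx, huE]
  have hNN : y ᵥ* N ᵥ* N = (a * a - u i * a) • y + (1 - a) • u := by
    rw [hNy, sub_vecMul, smul_vecMul, hNy, hNu]
    simp only [smul_sub, sub_smul, mul_smul, one_smul]
    abel
  have h0 := vecMul_vecMul_eq_zero_of_isNilpotent hN (y := y)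
    (c := a * a - u i * a + (1 - a) * a) (d := a - 1) (by
      rw [hNN, hNy]
      simp only [smul_sub, sub_smul, add_smul, mul_smul, one_smul]
      abel)
  by_contra! hcon
  have ha1 : 1 - a ≠ 0 := sub_ne_zero.2 (Ne.symm hcon.2)
  -- Since `y N² = 0` and `1 - a` is invertible, `u` is a multiple of `y`, making `y` an eigenvector
  -- of both `N` and `E`.
  obtain ⟨μ, hμ⟩ : ∃ μ : D, u = μ • y := by
    refine ⟨(1 - a)⁻¹ * (-(a * a - u i * a)), ?_⟩
    rw [mul_smul, eq_inv_smul_iff₀ ha1, neg_smul, eq_neg_iff_add_eq_zero, add_comm, ← hNN, h0]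
  have hev := eigenvalue_eq_zero_of_isNilpotent hN hy0 (c := a - μ) (by
    rw [hNy, hμ, sub_smul])
  obtain rfl : a = μ := sub_eq_zero.1 hev
  rw [hμ, smul_vecMul, ← hu, hμ, ← sub_eq_zero, ← smul_sub, smul_eq_zero, or_iff_right hcon.1,
    show a • y - y = (a - 1) • y by rw [sub_smul, one_smul], smul_eq_zero, or_iff_left hy0,
    sub_eq_zero] at huE
  exact hcon.2 huE

/-- In characteristic three, `-1 - e₁₁` is not nil-clean once the size is at least two. -/
theorem not_isNilCleanElem_of_three_eq_zero (h3 : (3 : D) = 0) {i j : ι} (hij : j ≠ i) :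
    ¬ IsNilCleanElem (-1 - Matrix.single i i (1 : D)) := by
  rintro ⟨N, E, hN, hE, hA⟩
  have hD : (-1 - 1 : D) = 1 := by
    rw [show (-1 - 1 : D) = 1 - 3 by norm_num, h3, sub_zero]
  set y : ι → D := Pi.single i 1 with hy
  have hy0 : y ≠ 0 := by simp [hy]
  have hNx : ∀ x : ι → D, x ᵥ* N = -x - x i • y - x ᵥ* E := fun x => by
    have := vecMul_single i (1 : D) x
    rw [mul_one] at this
    rw [← this, eq_sub_iff_add_eq, ← vecMul_add, ← hA, vecMul_sub, vecMul_neg, vecMul_one]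
  set u := y ᵥ* E with hu
  have huE : u ᵥ* E = u := by rw [hu, vecMul_vecMul, hE]
  have hs : ∀ x : ι → D, -x - x = x := fun x => by
    have : (-1 - 1 : D) • x = x := by rw [hD, one_smul]
    rwa [sub_smul, neg_smul, one_smul] at this
  have hNy : y ᵥ* N = y - u := by
    rw [hNx, ← hu]
    simp [hy, hs]
  have hNu : u ᵥ* N = u - u i • y := by
    rw [hNx, huE, sub_right_comm, hs]
  have hNN : y ᵥ* N ᵥ* N = (1 + u i) • y + u := by
    rw [hNy, sub_vecMul, hNy, hNu]
    calc y - u - (u - u i • y) = (1 + u i) • y + (-u - u) := by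
          rw [add_smul, one_smul]
          abel
      _ = _ := by rw [hs]
  have h0 := vecMul_vecMul_eq_zero_of_isNilpotent hN (y := y) (c := 1 + u i + 1) (d := -1) (by
    rw [hNN, hNy]
    simp only [smul_sub, add_smul, neg_smul, one_smul]
    abel)
  rw [hNN, add_comm, add_eq_zero_iff_eq_neg, ← neg_smul] at h0
  have hev' : (1 - -(1 + u i)) • y = y - -(1 + u i) • y := by rw [sub_smul, one_smul]
  have hev := eigenvalue_eq_zero_of_isNilpotent hN hy0 (c := 1 - -(1 + u i)) (by
    rw [hNy, hev']; nth_rewrite 1 [h0]; rfl)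
  have hNy0 : y ᵥ* N = 0 := by
    rw [hNy]; nth_rewrite 1 [h0]; rw [← hev', hev, zero_smul]
  -- Modulo `y`, `N = -1 - E`, so `N² = 1 + 3E = 1`; this contradicts nilpotency as the quotient by
  -- `y` is nonzero.
  have hN2 : ∀ x : ι → D, ∃ c : D, x ᵥ* N ᵥ* N = x + c • y := by
    intro x
    have huy : u = y := (sub_eq_zero.1 (hNy.symm.trans hNy0)).symm
    refine ⟨-(-x - x ᵥ* E) i, ?_⟩
    have h1 : x ᵥ* N = (-x - x ᵥ* E) - x i • y := by rw [hNx]; abel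
    rw [h1, sub_vecMul, smul_vecMul, hNy0, smul_zero, sub_zero, hNx, sub_vecMul, neg_vecMul,
      vecMul_vecMul, hE]
    have := hs (x ᵥ* E)
    rw [neg_smul, sub_right_comm, sub_eq_add_neg]
    congr 1
    have h3' : x ᵥ* E + x ᵥ* E + x ᵥ* E = 0 := by
      nth_rewrite 3 [← this]; abel
    calc _ = x + (x ᵥ* E + x ᵥ* E + x ᵥ* E) := by abel
      _ = x := by rw [h3', add_zero]
  have hpow : ∀ k : ℕ, ∃ c : D, Pi.single j (1 : D) ᵥ* N ^ (2 * k) = Pi.single j 1 + c • y := by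
    intro k
    induction k with
    | zero => exact ⟨0, by simp⟩
    | succ k ih =>
      obtain ⟨c, hc⟩ := ih
      obtain ⟨c', hc'⟩ := hN2 (Pi.single j 1)
      refine ⟨c', ?_⟩
      rw [mul_add, mul_one, pow_add, ← vecMul_vecMul, hc, pow_two, ← vecMul_vecMul, add_vecMul,
        add_vecMul, hc', smul_vecMul, hNy0, smul_zero, zero_vecMul, add_zero]
  obtain ⟨k, hk⟩ := hN
  obtain ⟨c, hc⟩ := hpow k
  rw [mul_comm, pow_mul, hk, zero_pow two_ne_zero, vecMul_zero] at hc
  have := congrFun hc j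
  simp [hy, hij] at this

end RowVectors

/-! ### Transfer, small fields and conclusion -/

section Transfer

theorem IsWeaklyNilCleanRing.of_ringEquiv {R S : Type*} [Ring R] [Ring S] (f : R ≃+* S)
    (h : IsWeaklyNilCleanRing R) : IsWeaklyNilCleanRing S := by
  intro a
  obtain ⟨b, e, hb, he, hab⟩ := h (f.symm a)
  refine ⟨f b, f e, hb.map f, he.map f, ?_⟩
  rw [RingEquiv.symm_apply_eq, RingEquiv.symm_apply_eq, map_add, map_sub] at hab
  exact hab

theorem IsNilCleanElem.isWeaklyNilCleanElem {R : Type*} [Ring R] {a : R} (h : IsNilCleanElem a) :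
    IsWeaklyNilCleanElem a :=
  let ⟨b, e, hb, he, hab⟩ := h
  ⟨b, e, hb, he, Or.inl hab⟩

theorem IsWeaklyNilCleanElem.or_neg {R : Type*} [Ring R] {a : R} (h : IsWeaklyNilCleanElem a) :
    IsNilCleanElem a ∨ IsNilCleanElem (-a) := by
  obtain ⟨b, e, hb, he, rfl | rfl⟩ := h
  · exact Or.inl ⟨b, e, hb, he, rfl⟩
  · exact Or.inr ⟨-b, e, hb.neg, he, by abel⟩

theorem IsNilCleanElem.one_sub {R : Type*} [Ring R] {a : R} (h : IsNilCleanElem a) :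
    IsNilCleanElem (1 - a) := by
  obtain ⟨b, e, hb, he, rfl⟩ := h
  exact ⟨-b, 1 - e, hb.neg, he.one_sub, by abel⟩

theorem isWeaklyNilCleanRing_matrix_zmod_two (n : ℕ) :
    IsWeaklyNilCleanRing (Matrix (Fin n) (Fin n) (ZMod 2)) :=
  IsWeaklyNilCleanRing.of_ringEquiv
    (Matrix.toLinAlgEquiv' (R := ZMod 2) (n := Fin n)).toRingEquiv.symm
    fun T => (isNilCleanElem_end_zmod_two _ T).isWeaklyNilCleanElem

theorem isWeaklyNilCleanRing_matrix_one_zmod_three :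
    IsWeaklyNilCleanRing (Matrix (Fin 1) (Fin 1) (ZMod 3)) := by
  refine IsWeaklyNilCleanRing.of_ringEquiv
    (Matrix.uniqueRingEquiv (m := Fin 1) (A := ZMod 3)).symm fun a => ?_
  have : ∀ a : ZMod 3, a = 0 ∨ a = 1 ∨ a = -1 := by decide
  rcases this a with rfl | rfl | rfl
  · exact ⟨0, 0, IsNilpotent.zero, IsIdempotentElem.zero, by simp⟩
  · exact ⟨0, 1, IsNilpotent.zero, IsIdempotentElem.one, by simp⟩
  · exact ⟨0, 1, IsNilpotent.zero, IsIdempotentElem.one, by simp⟩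

theorem nonempty_ringEquiv_zmod_two_or_three {D : Type*} [DivisionRing D]
    (h : ∀ a : D, a = 0 ∨ a = 1 ∨ a = -1) :
    Nonempty (D ≃+* ZMod 2) ∨ Nonempty (D ≃+* ZMod 3) := by
  classical
  have huniv : ∀ a : D, a ∈ ({0, 1, -1} : Finset D) := fun a => by simpa using h a
  let _ : Fintype D := ⟨{0, 1, -1}, huniv⟩
  have hcard : Fintype.card D = ({0, 1, -1} : Finset D).card := rfl
  by_cases h1 : (1 : D) = -1
  · left
    refine ⟨(ZMod.ringEquivOfPrime D Nat.prime_two ?_).symm⟩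
    rw [hcard, ← h1]
    simp
  · right
    refine ⟨(ZMod.ringEquivOfPrime D Nat.prime_three ?_).symm⟩
    rw [hcard, Finset.card_eq_three]
    exact ⟨0, 1, -1, by simp, by simp, h1, rfl⟩

end Transfer

theorem theorem4p7 {D : Type*} [DivisionRing D] (n : ℕ) (hn : 1 ≤ n) :
    IsWeaklyNilCleanRing (Matrix (Fin n) (Fin n) D) ↔
      (Nonempty (D ≃+* ZMod 2) ∨ (Nonempty (D ≃+* ZMod 3) ∧ n = 1)) := by
  constructor
  · intro h
    have hneg : ∀ a : D, -Matrix.single (⟨0, hn⟩ : Fin n) (⟨0, hn⟩ : Fin n) a =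
        Matrix.single ⟨0, hn⟩ ⟨0, hn⟩ (-a) := fun a =>
      (map_neg (Matrix.singleAddMonoidHom (α := D) (⟨0, hn⟩ : Fin n) (⟨0, hn⟩ : Fin n)) a).symm
    have hD : ∀ a : D, a = 0 ∨ a = 1 ∨ a = -1 := by
      intro a
      rcases (h (Matrix.single ⟨0, hn⟩ ⟨0, hn⟩ a)).or_neg with h' | h'
      · have := eq_zero_or_one_of_isNilCleanElem_single h'
        tauto
      · rw [hneg] at h'
        rcases eq_zero_or_one_of_isNilCleanElem_single h' with h0 | h0
        · exact Or.inl (neg_eq_zero.1 h0)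
        · exact Or.inr (Or.inr (neg_eq_iff_eq_neg.1 h0))
    refine (nonempty_ringEquiv_zmod_two_or_three hD).imp_right fun h3 => ⟨h3, ?_⟩
    by_contra hn1
    obtain ⟨f⟩ := h3
    have h3' : (3 : D) = 0 := f.injective (by rw [map_ofNat, map_zero]; decide)
    rcases (h (-1 - Matrix.single ⟨0, hn⟩ ⟨0, hn⟩ 1)).or_neg with h' | h'
    · exact not_isNilCleanElem_of_three_eq_zero h3' (j := ⟨1, by omega⟩)
        (fun h01 => absurd (congrArg Fin.val h01) one_ne_zero) h'
    -- If `1 + e₁₁` were nil-clean, so would be `1 - (1 + e₁₁) = -e₁₁`, although `-1` is neither `0`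
    -- nor `1`.
    · have h'' := h'.one_sub
      rw [show (1 : Matrix (Fin n) (Fin n) D) - -(-1 - Matrix.single ⟨0, hn⟩ ⟨0, hn⟩ 1) =
        -Matrix.single ⟨0, hn⟩ ⟨0, hn⟩ 1 by abel, hneg] at h''
      rcases eq_zero_or_one_of_isNilCleanElem_single h'' with h0 | h0
      · simp at h0
      · have : (1 : D) = 0 := by
          rw [← h3', show (3 : D) = 1 - -1 + 1 by norm_num, h0, sub_self, zero_add]
        exact one_ne_zero this
  · rintro (⟨⟨f⟩⟩ | ⟨⟨f⟩, rfl⟩)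
    · exact (isWeaklyNilCleanRing_matrix_zmod_two n).of_ringEquiv f.symm.mapMatrix
    · exact isWeaklyNilCleanRing_matrix_one_zmod_three.of_ringEquiv f.symm.mapMatrix
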